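/- Let $G$ be a non-archimedean Polish group, i.e. a topological group whose topology is separable and completely metrizable and in which the open subgroups form a base of neighbourhoods of the identity $e$. Let $\mathrm{RUCB}(G)$ be the space of bounded functions $f\colon G\to\mathbb{C}$ that are right uniformly continuous: for every $\varepsilon>0$ there is a neighbourhood $V$ of $e$ such that $gh^{-1}\in V$ implies $|f(g)-f(h)|<\varepsilon$ for all $g,h\in G$. Call $G$ amenable if $\mathrm{RUCB}(G)$ has an invariant mean, i.e. a linear form $m\colon\mathrm{RUCB}(G)\to\mathbb{C}$ with $m(1)=1$, $m(\overline f)=\overline{m(f)}$, $m(f)\ge 0$ whenever $f\ge 0$, and $m({}^{s}f)=m(f)$ for all $f\in\mathrm{RUCB}(G)$ and $s\in G$, where ${}^{s}f(x)=f(s^{-1}x)$. Then the Cantor set $D^{\aleph_0}$, $D=\{0,1\}$, is a test space for the amenability of such groups: $G$ is amenable if and only if every continuous action $G\times D^{\aleph_0}\to D^{\aleph_0}$ (jointly continuous) has an invariant Borel probability measure. -/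

import Mathlib

open Set Filter Topology MeasureTheory BoundedContinuousFunction

section Amenability

open scoped ComplexOrder

/-- `f : G → ℂ` is right uniformly continuous: for every `ε > 0` there is a neighbourhood `V` of
the identity such that `g * h⁻¹ ∈ V` implies `‖f g - f h‖ < ε`. -/
def IsRightUniformlyContinuous {G : Type*} [Group G] [TopologicalSpace G] (f : G → ℂ) : Prop :=
  ∀ ε : ℝ, 0 < ε → ∃ V ∈ 𝓝 (1 : G), ∀ g h : G, g * h⁻¹ ∈ V → ‖f g - f h‖ < ε

theorem IsRightUniformlyContinuous.add {G : Type*} [Group G] [TopologicalSpace G] {f k : G → ℂ}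
    (hf : IsRightUniformlyContinuous f) (hk : IsRightUniformlyContinuous k) :
    IsRightUniformlyContinuous (fun x => f x + k x) := by
  intro ε hε
  obtain ⟨V, hV, hVf⟩ := hf (ε / 2) (by positivity)
  obtain ⟨W, hW, hWk⟩ := hk (ε / 2) (by positivity)
  refine ⟨V ∩ W, inter_mem hV hW, fun g h hgh => ?_⟩
  calc ‖f g + k g - (f h + k h)‖ = ‖(f g - f h) + (k g - k h)‖ := by congr 1; ring
    _ ≤ ‖f g - f h‖ + ‖k g - k h‖ := norm_add_le _ _
    _ < ε / 2 + ε / 2 := add_lt_add (hVf g h hgh.1) (hWk g h hgh.2)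
    _ = ε := by ring

theorem IsRightUniformlyContinuous.mul {G : Type*} [Group G] [TopologicalSpace G] {f k : G → ℂ}
    (hf : IsRightUniformlyContinuous f) (hk : IsRightUniformlyContinuous k) {A B : ℝ}
    (hA : ∀ x, ‖f x‖ ≤ A) (hB : ∀ x, ‖k x‖ ≤ B) :
    IsRightUniformlyContinuous (fun x => f x * k x) := by
  intro ε hε
  have hA0 : 0 ≤ A := (norm_nonneg _).trans (hA 1)
  have hB0 : 0 ≤ B := (norm_nonneg _).trans (hB 1)
  obtain ⟨V, hV, hVf⟩ := hf (ε / (2 * (B + 1))) (by positivity)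
  obtain ⟨W, hW, hWk⟩ := hk (ε / (2 * (A + 1))) (by positivity)
  refine ⟨V ∩ W, inter_mem hV hW, fun g h hgh => ?_⟩
  have h1 := hVf g h hgh.1
  have h2 := hWk g h hgh.2
  rw [lt_div_iff₀ (by positivity)] at h1 h2
  have h3 : ‖f g - f h‖ * ‖k g‖ ≤ ‖f g - f h‖ * B :=
    mul_le_mul_of_nonneg_left (hB g) (norm_nonneg _)
  have h4 : ‖f h‖ * ‖k g - k h‖ ≤ A * ‖k g - k h‖ :=
    mul_le_mul_of_nonneg_right (hA h) (norm_nonneg _)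
  have h5 : ‖f g * k g - f h * k h‖ ≤ ‖f g - f h‖ * ‖k g‖ + ‖f h‖ * ‖k g - k h‖ := by
    rw [← norm_mul, ← norm_mul]
    calc ‖f g * k g - f h * k h‖ = ‖(f g - f h) * k g + f h * (k g - k h)‖ := by congr 1; ring
      _ ≤ _ := norm_add_le _ _
  nlinarith [norm_nonneg (f g - f h), norm_nonneg (k g - k h)]

/-- `RUCB(G)`: the unital star-algebra of bounded right uniformly continuous functions `G → ℂ`.
(A right uniformly continuous function on a topological group is continuous, so taking it inside
the bounded continuous functions is no restriction.) -/
noncomputable def RUCB (G : Type*) [Group G] [TopologicalSpace G] : StarSubalgebra ℂ (G →ᵇ ℂ) where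
  carrier := {f | IsRightUniformlyContinuous (f : G → ℂ)}
  mul_mem' := fun {f k} hf hk =>
    IsRightUniformlyContinuous.mul hf hk (fun x => f.norm_coe_le_norm x)
      (fun x => k.norm_coe_le_norm x)
  add_mem' := fun hf hk => IsRightUniformlyContinuous.add hf hk
  algebraMap_mem' := fun c ε hε => ⟨univ, univ_mem, fun g h _ => by
    change ‖(algebraMap ℂ (G →ᵇ ℂ) c) g - (algebraMap ℂ (G →ᵇ ℂ) c) h‖ < ε
    simpa [BoundedContinuousFunction.algebraMap_apply] using hε⟩
  star_mem' := fun {f} hf ε hε => by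
    obtain ⟨V, hV, h⟩ := hf ε hε
    refine ⟨V, hV, fun x y hxy => ?_⟩
    have := h x y hxy
    rwa [BoundedContinuousFunction.star_apply, BoundedContinuousFunction.star_apply, ← star_sub,
      norm_star]

/-- The left translate `ˢf : x ↦ f (s⁻¹ * x)` of `f ∈ RUCB(G)`, again an element of `RUCB(G)`. -/
noncomputable def RUCB.leftTranslate {G : Type*} [Group G] [TopologicalSpace G] [IsTopologicalGroup G]
    (s : G) (f : RUCB G) : RUCB G :=
  ⟨(f : G →ᵇ ℂ).compContinuous ⟨fun x => s⁻¹ * x, continuous_const_mul s⁻¹⟩, fun ε hε => by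
    obtain ⟨V, hV, h⟩ := f.2 ε hε
    have hc : Continuous fun x : G => s⁻¹ * x * s := by fun_prop
    refine ⟨(fun x : G => s⁻¹ * x * s) ⁻¹' V, hc.continuousAt.preimage_mem_nhds (by simpa using hV),
      fun x y hxy => h (s⁻¹ * x) (s⁻¹ * y) ?_⟩
    have : s⁻¹ * x * (s⁻¹ * y)⁻¹ = s⁻¹ * (x * y⁻¹) * s := by group
    rw [this]
    exact hxy⟩

/-- An invariant mean on `RUCB(G)`: a linear form `m` with `m 1 = 1`, `m (conj f) = conj (m f)`,
`m f ≥ 0` whenever `f ≥ 0`, and `m (ˢf) = m f` for all `s`. (In the order on `ℂ`, `0 ≤ z` means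
that `z` is a nonnegative real.) -/
structure IsInvariantMean {G : Type*} [Group G] [TopologicalSpace G] [IsTopologicalGroup G]
    (m : RUCB G →ₗ[ℂ] ℂ) : Prop where
  map_one : m 1 = 1
  map_star : ∀ f : RUCB G, m (star f) = star (m f)
  nonneg : ∀ f : RUCB G, (∀ x : G, 0 ≤ (f : G →ᵇ ℂ) x) → 0 ≤ m f
  invariant : ∀ (s : G) (f : RUCB G), m (RUCB.leftTranslate s f) = m f

/-- A topological group `G` is amenable if `RUCB(G)` carries an invariant mean. -/
def IsAmenableGroup (G : Type*) [Group G] [TopologicalSpace G] [IsTopologicalGroup G] : Prop :=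
  ∃ m : RUCB G →ₗ[ℂ] ℂ, IsInvariantMean m

end Amenability

/-!
Amenability of a non-archimedean Polish group `G` is tested by its actions on the Cantor space.

If `G` is amenable and acts continuously on a compact metrizable space, then composing continuous
functions with an orbit map gives right uniformly continuous functions, to which an invariant mean
can be applied; the measure that represents the resulting positive functional by the
Riesz–Markov–Kakutani theorem is invariant (`IsAmenableGroup.exists_invariant_measure`).

For the converse, invariant measures are first extended from the Cantor space to every
zero-dimensional compact metrizable `G`-space `X`: by Brouwer's theorem
(`nonempty_homeomorph_cantor`), the product of `X` with a Cantor space carrying the trivial action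
is itself a Cantor space (`exists_invariant_measure_of_cantor`). Now let `F` be a finitely valued
function on `G`, invariant under left multiplication by an open subgroup `V`. Since `G ⧸ V` is
countable, the functions `s V ↦ F (s⁻¹ * g)` on `G ⧸ V` have as their closure such a space `X`. An
invariant measure on `X` is moved back to `G`, giving a probability measure that integrates `F` and
any finitely many prescribed translates of `F` alike (`exists_measure_invariant_on_finite`).
Because `G` is non-archimedean, any finite set of elements of `RUCB G` is approximated uniformly by
functions of one such `F` (`exists_finite_approximation`). An ultrafilter limit of the measures so
obtained is an invariant mean (`isAmenableGroup_of_approximately_invariant`).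
-/

/-! ### Brouwer's characterization of the Cantor space -/

section Brouwer

open TopologicalSpace

variable {Y : Type*} [TopologicalSpace Y]

/-- The binary tree of clopen sets obtained by splitting: at depth `n` a node `C` is cut into the
children `C ∩ σ n C` (branch `true`) and `C \ σ n C` (branch `false`). A node is addressed by the
list of its branches, the latest one first. -/
def splitCell (σ : ℕ → Clopens Y → Clopens Y) : List Bool → Clopens Y
  | [] => ⊤
  | b :: l =>
    splitCell σ l ⊓ (if b then σ l.length (splitCell σ l) else (σ l.length (splitCell σ l))ᶜ)

/-- The address of the node at depth `n` of the tree `splitCell σ` that contains the point `y`. -/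
noncomputable def splitCode (σ : ℕ → Clopens Y → Clopens Y) (y : Y) : ℕ → List Bool
  | 0 => []
  | n + 1 => by
    classical
    exact decide (y ∈ σ n (splitCell σ (splitCode σ y n))) :: splitCode σ y n

/-- The branch of the tree `splitCell σ` followed by the point `y`. -/
noncomputable def splitBranch (σ : ℕ → Clopens Y → Clopens Y) (y : Y) (n : ℕ) : Bool := by
  classical
  exact decide (y ∈ σ n (splitCell σ (splitCode σ y n)))

/-- The initial segment of length `n` of a binary sequence, the latest entry first. -/
def revPrefix (x : ℕ → Bool) : ℕ → List Bool
  | 0 => []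
  | n + 1 => x n :: revPrefix x n

theorem length_revPrefix (x : ℕ → Bool) (n : ℕ) : (revPrefix x n).length = n := by
  induction n with
  | zero => rfl
  | succ n ih => simp [revPrefix, ih]

theorem splitCode_eq_revPrefix (σ : ℕ → Clopens Y → Clopens Y) (y : Y) (n : ℕ) :
    splitCode σ y n = revPrefix (splitBranch σ y) n := by
  induction n with
  | zero => rfl
  | succ n ih => rw [revPrefix, ← ih]; rfl

theorem mem_splitCell_splitCode (σ : ℕ → Clopens Y → Clopens Y) (y : Y) (n : ℕ) :
    y ∈ splitCell σ (splitCode σ y n) := by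
  induction n with
  | zero => exact mem_univ y
  | succ n ih =>
    have hl : (splitCode σ y n).length = n := by rw [splitCode_eq_revPrefix, length_revPrefix]
    rw [splitCode, splitCell, hl]
    refine ⟨ih, ?_⟩
    by_cases h : y ∈ σ n (splitCell σ (splitCode σ y n))
    · simp [h]
    · simp [h]

/-- If `y` lies in every node along the branch `x`, then `x` is the branch followed by `y`. -/
theorem splitBranch_eq_of_forall_mem (σ : ℕ → Clopens Y → Clopens Y) (x : ℕ → Bool) (y : Y)
    (h : ∀ n, y ∈ splitCell σ (revPrefix x n)) : splitBranch σ y = x := by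
  have hcode : ∀ n, splitCode σ y n = revPrefix x n ∧ splitBranch σ y n = x n := by
    intro n
    have step : ∀ n, splitCode σ y n = revPrefix x n → splitBranch σ y n = x n := by
      intro n hn
      have h1 := (h (n + 1)).2
      rw [length_revPrefix] at h1
      unfold splitBranch
      rw [hn]
      cases hx : x n
      · rw [hx] at h1
        simpa using h1
      · rw [hx] at h1
        simpa using h1
    induction n with
    | zero => exact ⟨rfl, step 0 rfl⟩
    | succ n ih =>
      have : splitCode σ y (n + 1) = revPrefix x (n + 1) := by
        rw [revPrefix, ← ih.1, ← ih.2]; rfl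
      exact ⟨this, step _ this⟩
  exact funext fun n => (hcode n).2

theorem isLocallyConstant_splitCode (σ : ℕ → Clopens Y → Clopens Y) (n : ℕ) :
    IsLocallyConstant fun y => splitCode σ y n := by
  rw [IsLocallyConstant.iff_eventually_eq]
  induction n with
  | zero => exact fun y => Eventually.of_forall fun _ => rfl
  | succ n ih =>
    intro y
    have hmem : ∀ S : Clopens Y, ∀ᶠ z in 𝓝 y, (z ∈ S ↔ y ∈ S) := by
      intro S
      by_cases hy : y ∈ S
      · filter_upwards [S.isClopen.isOpen.mem_nhds hy] with z hz
        exact iff_of_true hz hy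
      · filter_upwards [S.isClopen.compl.isOpen.mem_nhds hy] with z hz
        exact iff_of_false hz hy
    filter_upwards [ih y, hmem (σ n (splitCell σ (splitCode σ y n)))] with z hz hzS
    simp only [splitCode, List.cons.injEq, decide_eq_decide]
    exact ⟨by rwa [hz], hz⟩

theorem continuous_splitBranch (σ : ℕ → Clopens Y → Clopens Y) : Continuous (splitBranch σ) := by
  refine continuous_pi fun n => ?_
  have : (fun y => splitBranch σ y n) = fun y => (splitCode σ y (n + 1)).headI := rfl
  rw [this]
  exact ((isLocallyConstant_splitCode σ (n + 1)).comp List.headI).continuous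

/-- A nonempty clopen set of a perfect zero-dimensional compact space can be cut into two nonempty
clopen pieces, neither of which is cut by the prescribed clopen set `U`. -/
theorem exists_clopens_split [CompactSpace Y] [T2Space Y] [TotallyDisconnectedSpace Y]
    [PerfectSpace Y] (U C : Clopens Y) :
    ∃ S : Clopens Y,
      ((C : Set Y).Nonempty → ((C : Set Y) ∩ S).Nonempty ∧ ((C : Set Y) \ S).Nonempty) ∧
      ∀ y ∈ C, ∀ z ∈ C, (y ∈ S ↔ z ∈ S) → (y ∈ U ↔ z ∈ U) := by
  by_cases hU : ((C : Set Y) ∩ U).Nonempty ∧ ((C : Set Y) \ U).Nonempty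
  · exact ⟨U, fun _ => hU, fun _ _ _ _ h => h⟩
  have htriv : ∀ y ∈ C, ∀ z ∈ C, (y ∈ U ↔ z ∈ U) := by
    intro y hy z hz
    by_contra hyz
    refine hU ?_
    by_cases h : y ∈ U
    · exact ⟨⟨y, hy, h⟩, ⟨z, hz, fun h' => hyz (iff_of_true h h')⟩⟩
    · exact ⟨⟨z, hz, by_contra fun h' => hyz (iff_of_false h h')⟩, ⟨y, hy, h⟩⟩
  rcases (C : Set Y).eq_empty_or_nonempty with hC | ⟨y, hy⟩
  · exact ⟨⊤, fun h => absurd h (by simp [hC]), fun y hy z hz _ => htriv y hy z hz⟩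
  have hne : ((C : Set Y) ∩ {y}ᶜ).Nonempty := by
    have hnhds : (C : Set Y) ∈ 𝓝 y := C.isClopen.isOpen.mem_nhds hy
    exact (inferInstance : NeBot (𝓝[≠] y)).nonempty_of_mem
      (inter_mem (mem_nhdsWithin_of_mem_nhds hnhds) self_mem_nhdsWithin)
  obtain ⟨z, hz, hzy⟩ := hne
  obtain ⟨S, hS, hyS, hzS⟩ := exists_isClopen_of_totally_separated (Ne.symm hzy)
  exact ⟨⟨S, hS⟩, fun _ => ⟨⟨y, hy, hyS⟩, ⟨z, hz, hzS⟩⟩, fun y hy z hz _ => htriv y hy z hz⟩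

/-- **Brouwer's theorem**: a nonempty, perfect, totally disconnected, compact, second countable
Hausdorff space is homeomorphic to the Cantor space. -/
theorem nonempty_homeomorph_cantor (Y : Type*) [TopologicalSpace Y] [CompactSpace Y] [T2Space Y]
    [TotallyDisconnectedSpace Y] [SecondCountableTopology Y] [PerfectSpace Y] [Nonempty Y] :
    Nonempty (Y ≃ₜ (ℕ → Bool)) := by
  have hcount : Countable (Clopens Y) :=
    Clopens.countable_iff_secondCountable.mpr inferInstance
  obtain ⟨U, hU⟩ := exists_surjective_nat (Clopens Y)
  -- The `n`-th splitting decides membership in the `n`-th clopen set of the enumeration.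
  choose σ hσ hσU using fun n => exists_clopens_split (U n)
  have hne : ∀ l, (splitCell σ l : Set Y).Nonempty := by
    intro l
    induction l with
    | nil => exact univ_nonempty
    | cons b l ih =>
      have := hσ l.length (splitCell σ l) ih
      cases b
      · simpa [splitCell, sdiff_eq] using this.2
      · simpa [splitCell] using this.1
  have hsurj : Function.Surjective (splitBranch σ) := by
    intro x
    obtain ⟨y, hy⟩ := IsCompact.nonempty_iInter_of_sequence_nonempty_isCompact_isClosed
      (fun n => (splitCell σ (revPrefix x n) : Set Y)) (fun n _ hy => hy.1) (fun n => hne _)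
      (splitCell σ _).isClopen.isClosed.isCompact (fun n => (splitCell σ _).isClopen.isClosed)
    exact ⟨y, splitBranch_eq_of_forall_mem σ x y (mem_iInter.mp hy)⟩
  have hinj : Function.Injective (splitBranch σ) := by
    intro y z hyz
    by_contra hne
    obtain ⟨S, hS, hyS, hzS⟩ := exists_isClopen_of_totally_separated hne
    obtain ⟨n, hn⟩ := hU ⟨S, hS⟩
    have hcode : splitCode σ z n = splitCode σ y n := by
      rw [splitCode_eq_revPrefix, splitCode_eq_revPrefix, hyz]
    have hdec := congrFun hyz n
    simp only [splitBranch, hcode, decide_eq_decide] at hdec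
    have := hσU n _ y (mem_splitCell_splitCode σ y n) z (hcode ▸ mem_splitCell_splitCode σ z n) hdec
    rw [hn] at this
    exact hzS (this.mp hyS)
  exact ⟨(continuous_splitBranch σ).homeoOfEquivCompactToT2
    (f := Equiv.ofBijective _ ⟨hinj, hsurj⟩)⟩

theorem perfectSpace_prod_right (X Y : Type*) [TopologicalSpace X] [TopologicalSpace Y]
    [PerfectSpace Y] : PerfectSpace (X × Y) := by
  rw [perfectSpace_iff_forall_not_isolated]
  rintro ⟨x, y⟩
  have hle : map (Prod.mk x) (𝓝[≠] y) ≤ 𝓝[≠] (x, y) :=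
    tendsto_nhdsWithin_iff.mpr ⟨((Continuous.prodMk_right x).tendsto y).mono_left nhdsWithin_le_nhds,
      eventually_nhdsWithin_of_forall fun z hz h => hz (congrArg Prod.snd h)⟩
  exact NeBot.mono inferInstance hle

theorem perfectSpace_cantor : PerfectSpace (ℕ → Bool) := by
  rw [perfectSpace_iff_forall_not_isolated]
  intro x
  -- The points `x` with the `n`-th entry flipped converge to `x`.
  have htends : Tendsto (fun n => Function.update x n (!x n)) atTop (𝓝[≠] x) := by
    refine tendsto_nhdsWithin_iff.mpr ⟨tendsto_pi_nhds.mpr fun k => ?_,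
      Eventually.of_forall fun n h => ?_⟩
    · refine tendsto_const_nhds.congr' ?_
      filter_upwards [eventually_gt_atTop k] with n hn
      rw [Function.update_of_ne hn.ne]
    · simpa using congrFun h n
  exact htends.neBot

end Brouwer

/-! ### From means to invariant measures -/

section InvariantMeasure

open scoped ComplexOrder

variable {G X : Type*} [Group G] [TopologicalSpace G]
  [TopologicalSpace X] [CompactSpace X] [MulAction G X] [ContinuousSMul G X]

/-- Orbit maps of a continuous action on a compact space are right uniformly continuous, uniformly
in the base point, after composition with a continuous function. -/
theorem isRightUniformlyContinuous_orbit (x : X) (f : C(X, ℝ)) :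
    IsRightUniformlyContinuous fun g : G => (f (g • x) : ℂ) := by
  intro ε hε
  have hev : ∀ᶠ v in 𝓝 (1 : G), ∀ y ∈ (univ : Set X), dist (f (v • y)) (f y) < ε := by
    refine isCompact_univ.eventually_forall_of_forall_eventually fun y _ => ?_
    have hc : Continuous fun p : G × X => dist (f (p.1 • p.2)) (f p.2) := by fun_prop
    exact hc.continuousAt.eventually_lt continuousAt_const (by simpa using hε)
  refine ⟨_, hev, fun g h hgh => ?_⟩
  have := hgh (h • x) (mem_univ _)
  rw [smul_smul, inv_mul_cancel_right, Real.dist_eq] at this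
  rwa [← Complex.ofReal_sub, Complex.norm_real]

/-- The function `g ↦ f (g • x)` as an element of `RUCB G`. -/
noncomputable def orbitRUCB (x : X) (f : C(X, ℝ)) : RUCB G :=
  ⟨BoundedContinuousFunction.ofNormedAddCommGroup (fun g : G => (f (g • x) : ℂ))
    (by fun_prop) ‖f‖ fun g => by
      rw [Complex.norm_real]; exact f.norm_coe_le_norm _,
    isRightUniformlyContinuous_orbit x f⟩

theorem orbitRUCB_apply (x : X) (f : C(X, ℝ)) (g : G) :
    ((orbitRUCB x f : RUCB G) : G →ᵇ ℂ) g = f (g • x) := rfl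

theorem RUCB.leftTranslate_apply [IsTopologicalGroup G] (s : G) (f : RUCB G) (g : G) :
    (RUCB.leftTranslate s f : G →ᵇ ℂ) g = (f : G →ᵇ ℂ) (s⁻¹ * g) := rfl

theorem RUCB.ext {f k : RUCB G} (h : ∀ g, (f : G →ᵇ ℂ) g = (k : G →ᵇ ℂ) g) : f = k :=
  Subtype.ext (BoundedContinuousFunction.ext h)

/-- Averaging continuous functions along an orbit against an invariant mean gives a positive
functional, and the measure representing it is an invariant probability measure. -/
theorem IsAmenableGroup.exists_invariant_measure [IsTopologicalGroup G] [T2Space X] [Nonempty X] [MeasurableSpace X]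
    [BorelSpace X] [HasOuterApproxClosed X] (hG : IsAmenableGroup G) :
    ∃ μ : Measure X, IsProbabilityMeasure μ ∧ SMulInvariantMeasure G X μ := by
  obtain ⟨m, hm⟩ := hG
  obtain ⟨x⟩ := ‹Nonempty X›
  let L : CompactlySupportedContinuousMap X ℝ →ₗ[ℝ] ℝ :=
    { toFun := fun f => (m (orbitRUCB x (f : C(X, ℝ)))).re
      map_add' := fun f k => by
        rw [← Complex.add_re, ← map_add]
        exact congrArg (fun u => (m u).re) (RUCB.ext fun g => Complex.ofReal_add _ _)
      map_smul' := fun c f => by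
        have : (orbitRUCB x ((c • f : CompactlySupportedContinuousMap X ℝ) : C(X, ℝ)) : RUCB G) =
            (c : ℂ) • orbitRUCB x (f : C(X, ℝ)) :=
          RUCB.ext fun g => Complex.ofReal_mul _ _
        rw [this, map_smul, smul_eq_mul, Complex.re_ofReal_mul]
        rfl }
  let Λ : CompactlySupportedContinuousMap X ℝ →ₚ[ℝ] ℝ := PositiveLinearMap.mk₀ L fun f hf =>
    (Complex.le_def.mp (hm.nonneg _ fun g => Complex.zero_le_real.mpr (hf (g • x)))).1
  have hint : ∀ f : C(X, ℝ),
      ∫ y, f y ∂(RealRMK.rieszMeasure Λ) = (m (orbitRUCB x f)).re := fun f =>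
    RealRMK.integral_rieszMeasure Λ (CompactlySupportedContinuousMap.continuousMapEquiv f)
  set μ := RealRMK.rieszMeasure Λ with hμ
  have hfin : IsFiniteMeasure μ := ⟨isCompact_univ.measure_lt_top⟩
  have hone : μ.real univ = 1 := by
    have h1 := hint 1
    have h2 : (orbitRUCB x 1 : RUCB G) = 1 := RUCB.ext fun g => Complex.ofReal_one
    rw [h2, hm.map_one] at h1
    simpa using h1
  refine ⟨μ, ⟨?_⟩, ?_⟩
  · rwa [Measure.real, ENNReal.toReal_eq_one_iff] at hone
  · have hmap : ∀ s : G, μ.map (s • ·) = μ := by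
      intro s
      have hs : Measurable fun y : X => s • y := (continuous_const_smul s).measurable
      have := Measure.isFiniteMeasure_map μ fun y : X => s • y
      refine ext_of_forall_integral_eq_of_IsFiniteMeasure fun f => ?_
      rw [integral_map hs.aemeasurable f.continuous.aestronglyMeasurable]
      have h1 := hint (f.toContinuousMap.comp ⟨fun y => s • y, continuous_const_smul s⟩)
      have h2 := hint f.toContinuousMap
      have h3 : (orbitRUCB x (f.toContinuousMap.comp ⟨fun y => s • y, continuous_const_smul s⟩) :
          RUCB G) = RUCB.leftTranslate s⁻¹ (orbitRUCB x f.toContinuousMap) :=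
        RUCB.ext fun g => by
          simp [orbitRUCB_apply, RUCB.leftTranslate_apply, mul_smul]
      rw [h3, hm.invariant, ← h2] at h1
      exact h1
    exact ⟨fun s A hA => by
      conv_rhs => rw [← hmap s]
      rw [Measure.map_apply (continuous_const_smul s).measurable hA]⟩

end InvariantMeasure

/-! ### From actions on the Cantor space to approximately invariant measures on the group -/

section Converse

variable {G : Type*} [Group G]

/-- The itinerary of `g` under a function `F` on `G` invariant under left multiplication by `V`:
it sends the coset `s V` to `F (s⁻¹ * g)`. The definition uses a representative of the coset. -/
noncomputable def itinerary {A : Type*} (V : Subgroup G) (F : G → A) (g : G) (c : G ⧸ V) : A :=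
  F (c.out⁻¹ * g)

theorem itinerary_mk {A : Type*} {V : Subgroup G} {F : G → A}
    (hF : ∀ v ∈ V, ∀ g, F (v * g) = F g) (g s : G) : itinerary V F g (s : G ⧸ V) = F (s⁻¹ * g) := by
  obtain ⟨v, hv⟩ := QuotientGroup.mk_out_eq_mul V s
  rw [itinerary, hv, mul_inv_rev, mul_assoc, hF _ (inv_mem v.2)]

theorem itinerary_mul {A : Type*} {V : Subgroup G} {F : G → A}
    (hF : ∀ v ∈ V, ∀ g, F (v * g) = F g) (h g : G) (c : G ⧸ V) :
    itinerary V F (h * g) c = itinerary V F g (h⁻¹ • c) := by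
  induction c using QuotientGroup.induction_on with
  | H s =>
    rw [MulAction.Quotient.smul_mk, itinerary_mk hF, smul_eq_mul]
    erw [itinerary_mk hF]
    congr 1
    group

variable [TopologicalSpace G]

/-- Multiplying a zero-dimensional space by a Cantor space with trivial action makes it a Cantor
space, so invariant measures for actions on the Cantor space give invariant measures on all
zero-dimensional compact metrizable spaces. -/
theorem exists_invariant_measure_of_cantor
    (H : ∀ (_ : MulAction G (ℕ → Bool)), ContinuousSMul G (ℕ → Bool) →
      ∃ μ : Measure (ℕ → Bool), IsProbabilityMeasure μ ∧ SMulInvariantMeasure G (ℕ → Bool) μ)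
    (X : Type*) [TopologicalSpace X] [CompactSpace X] [T2Space X] [TotallyDisconnectedSpace X]
    [SecondCountableTopology X] [Nonempty X] [MeasurableSpace X] [BorelSpace X] [MulAction G X]
    [ContinuousSMul G X] :
    ∃ μ : Measure X, IsProbabilityMeasure μ ∧ SMulInvariantMeasure G X μ := by
  have := perfectSpace_cantor
  have := perfectSpace_prod_right X (ℕ → Bool)
  obtain ⟨e⟩ := nonempty_homeomorph_cantor (X × (ℕ → Bool))
  let act : MulAction G (ℕ → Bool) :=
    { smul := fun g z => e (g • (e.symm z).1, (e.symm z).2)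
      one_smul := fun z => by
        change e ((1 : G) • (e.symm z).1, (e.symm z).2) = z
        simp
      mul_smul := fun g h z => by
        change e ((g * h) • (e.symm z).1, (e.symm z).2) =
          e (g • (e.symm (e (h • (e.symm z).1, (e.symm z).2))).1,
            (e.symm (e (h • (e.symm z).1, (e.symm z).2))).2)
        simp [mul_smul] }
  have hsmul : ∀ (g : G) (z : ℕ → Bool), g • z = e (g • (e.symm z).1, (e.symm z).2) :=
    fun _ _ => rfl
  obtain ⟨μ, hμ, hinv⟩ := H act ⟨by simp only [hsmul]; fun_prop⟩
  have hq : Measurable fun z => (e.symm z).1 := by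
    have : Continuous fun z => (e.symm z).1 := by fun_prop
    exact this.measurable
  refine ⟨μ.map fun z => (e.symm z).1, Measure.isProbabilityMeasure_map hq.aemeasurable,
    ⟨fun g B hB => ?_⟩⟩
  have hB' := (continuous_const_smul g).measurable hB
  rw [Measure.map_apply hq hB, Measure.map_apply hq hB', ← hinv.measure_preimage_smul g (hq hB)]
  congr 1
  ext z
  simp [hsmul]

theorem countable_quotient_of_isOpen [IsTopologicalGroup G] [TopologicalSpace.SeparableSpace G] (V : Subgroup G)
    (hV : IsOpen (V : Set G)) : Countable (G ⧸ V) := by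
  have := QuotientGroup.discreteTopology hV
  have : TopologicalSpace.SeparableSpace (G ⧸ V) :=
    QuotientGroup.mk_surjective.denseRange.separableSpace QuotientGroup.continuous_mk
  exact TopologicalSpace.separableSpace_iff_countable.mp this

theorem continuous_of_invariant [IsTopologicalGroup G] {A : Type*} [TopologicalSpace A]
    {V : Subgroup G} (hV : IsOpen (V : Set G)) {F : G → A}
    (hF : ∀ v ∈ V, ∀ g, F (v * g) = F g) : Continuous F := by
  refine IsLocallyConstant.continuous ((IsLocallyConstant.iff_eventually_eq F).mpr fun g => ?_)
  have hc : Continuous fun h : G => h * g⁻¹ := by fun_prop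
  filter_upwards [hc.continuousAt.preimage_mem_nhds
    (hV.mem_nhds (by simp))] with h hh
  simpa using hF _ hh g

/-- Let `F` be a finitely valued function invariant under left multiplication by an open subgroup
`V`. The closure of the set of itineraries is a zero-dimensional compact metrizable `G`-space. An
invariant measure on it is carried to `G` by replacing each point by the itinerary of an element of
`G` that agrees with it on the finitely many cosets of the elements of `S`. -/
theorem exists_measure_invariant_on_finite [IsTopologicalGroup G] [TopologicalSpace.SeparableSpace G]
    [MeasurableSpace G] [BorelSpace G]
    (H : ∀ (_ : MulAction G (ℕ → Bool)), ContinuousSMul G (ℕ → Bool) →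
      ∃ μ : Measure (ℕ → Bool), IsProbabilityMeasure μ ∧ SMulInvariantMeasure G (ℕ → Bool) μ)
    {A : Type*} [Finite A] [TopologicalSpace A] [DiscreteTopology A] {V : Subgroup G}
    (hV : IsOpen (V : Set G)) {F : G → A} (hF : ∀ v ∈ V, ∀ g, F (v * g) = F g) (S : Finset G) :
    ∃ ν : Measure G, IsProbabilityMeasure ν ∧ ∀ s ∈ S, ∀ τ : A → ℂ,
      ∫ g, τ (F (s⁻¹ * g)) ∂ν = ∫ g, τ (F g) ∂ν := by
  classical
  have := countable_quotient_of_isOpen V hV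
  have := QuotientGroup.discreteTopology hV
  have hFc := continuous_of_invariant hV hF
  let act : MulAction G (G ⧸ V → A) := arrowAction
  have hact : ∀ (g : G) (x : G ⧸ V → A) c, (g • x) c = x (g⁻¹ • c) := fun _ _ _ => rfl
  have hcont : ContinuousSMul G (G ⧸ V → A) := by
    refine ⟨continuous_pi fun c => ?_⟩
    have heval : Continuous fun p : (G ⧸ V) × (G ⧸ V → A) => p.2 p.1 :=
      continuous_prod_of_discrete_left.mpr continuous_apply
    have hsmul : Continuous fun p : G × (G ⧸ V → A) => (p.1⁻¹ • c, p.2) := by fun_prop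
    exact heval.comp hsmul
  have hequiv : ∀ h g, itinerary V F (h * g) = h • itinerary V F g := fun h g =>
    funext fun c => itinerary_mul hF h g c
  let X : SubMulAction G (G ⧸ V → A) :=
    { carrier := closure (range (itinerary V F))
      smul_mem' := fun g x hx => by
        refine map_mem_closure (continuous_const_smul g) hx ?_
        rintro _ ⟨h, rfl⟩
        exact ⟨g * h, hequiv g h⟩ }
  have hXclosed : IsClosed (X : Set (G ⧸ V → A)) := isClosed_closure
  have : CompactSpace X := isCompact_iff_compactSpace.mp hXclosed.isCompact
  have : SecondCountableTopology X :=
    TopologicalSpace.Subtype.secondCountableTopology (X : Set (G ⧸ V → A))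
  have : Nonempty X := ⟨⟨itinerary V F 1, subset_closure ⟨1, rfl⟩⟩⟩
  let _ : MeasurableSpace X := borel X
  have : BorelSpace X := ⟨rfl⟩
  obtain ⟨μ, hμ, hinv⟩ := exists_invariant_measure_of_cantor H X
  let T := insert 1 S
  -- The restrictions to `T` of the points of `X` are restrictions of itineraries.
  let ρ : (G ⧸ V → A) → T → A := fun x t => x ((t : G) : G ⧸ V)
  have hρ : Continuous ρ := by fun_prop
  let γ : (T → A) → G := Function.invFun fun g => ρ (itinerary V F g)
  have hγ : ∀ x : X, ρ (itinerary V F (γ (ρ x))) = ρ x := by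
    intro x
    refine Function.invFun_eq (f := fun g => ρ (itinerary V F g)) ?_
    obtain ⟨_, hy, g, rfl⟩ := mem_closure_iff.mp x.2 _
      ((isOpen_discrete {ρ x}).preimage hρ) rfl
    exact ⟨g, hy⟩
  have hγF : ∀ t ∈ T, ∀ x : X, F (t⁻¹ * γ (ρ x)) = (x : G ⧸ V → A) (t : G ⧸ V) := by
    intro t ht x
    rw [← itinerary_mk hF]
    exact congrFun (hγ x) ⟨t, ht⟩
  have hmeas : Measurable fun x : X => γ (ρ x) := by
    have hγc : Continuous γ := continuous_of_discreteTopology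
    have : Continuous fun x : X => γ (ρ x) := hγc.comp (hρ.comp continuous_subtype_val)
    exact this.measurable
  have hint : ∀ t ∈ T, ∀ τ : A → ℂ, ∫ g, τ (F (t⁻¹ * g)) ∂(μ.map fun x : X => γ (ρ x)) =
      ∫ x : X, τ ((x : G ⧸ V → A) ((1 : G) : G ⧸ V)) ∂μ := by
    intro t ht τ
    have hτ : Continuous fun g => τ (F (t⁻¹ * g)) :=
      continuous_of_discreteTopology.comp (hFc.comp (continuous_const_mul t⁻¹))
    rw [integral_map hmeas.aemeasurable
      (hτ.measurable.aestronglyMeasurable)]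
    simp only [hγF t ht]
    rw [← integral_smul_eq_self (fun x : X => τ ((x : G ⧸ V → A) ((1 : G) : G ⧸ V))) (g := t⁻¹)]
    refine integral_congr_ae (Eventually.of_forall fun x => ?_)
    change _ = τ ((t⁻¹ • (x : G ⧸ V → A)) ((1 : G) : G ⧸ V))
    rw [hact, inv_inv, MulAction.Quotient.smul_coe, smul_eq_mul, mul_one]
  refine ⟨μ.map fun x : X => γ (ρ x), Measure.isProbabilityMeasure_map hmeas.aemeasurable,
    fun s hs τ => ?_⟩
  rw [hint s (Finset.mem_insert_of_mem hs) τ, ← hint 1 (Finset.mem_insert_self 1 S) τ]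
  simp

/-- In a non-archimedean group, finitely many right uniformly continuous bounded functions are
approximated uniformly by functions factoring through a single finitely valued function invariant
under left multiplication by an open subgroup. -/
theorem exists_finite_approximation [NonarchimedeanGroup G] (Φ : Finset (RUCB G)) {ε : ℝ}
    (hε : 0 < ε) :
    ∃ (V : OpenSubgroup G) (T : Set ℂ) (_ : T.Finite) (F : G → Φ → T),
      (∀ v ∈ V, ∀ g, F (v * g) = F g) ∧ ∀ (f : Φ) g, ‖((f : RUCB G) : G →ᵇ ℂ) g - F g f‖ < ε := by
  choose W hW hWf using fun f : RUCB G => f.2 (ε / 2) (by positivity)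
  obtain ⟨V, hV⟩ := NonarchimedeanGroup.is_nonarchimedean (⋂ f ∈ Φ, W f)
    ((biInter_finset_mem Φ).mpr fun f _ => hW f)
  obtain ⟨T, hTfin, hT⟩ := Metric.totallyBounded_iff.mp
    (isCompact_closedBall (0 : ℂ) (∑ f ∈ Φ, ‖f‖)).totallyBounded (ε / 2) (by positivity)
  have hround : ∀ (f : Φ) (g : G), ∃ t : T, ‖((f : RUCB G) : G →ᵇ ℂ) g - t‖ < ε / 2 := by
    intro f g
    have hmem : ((f : RUCB G) : G →ᵇ ℂ) g ∈ Metric.closedBall (0 : ℂ) (∑ f ∈ Φ, ‖f‖) := by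
      rw [mem_closedBall_zero_iff]
      exact (((f : RUCB G) : G →ᵇ ℂ).norm_coe_le_norm g).trans
        (Finset.single_le_sum (f := fun f : RUCB G => ‖f‖) (fun _ _ => norm_nonneg _) f.2)
    obtain ⟨t, ht, hgt⟩ := mem_iUnion₂.mp (hT hmem)
    exact ⟨⟨t, ht⟩, by rwa [← dist_eq_norm]⟩
  choose r hr using hround
  -- Representatives of the right cosets of `V`.
  let p : G → G := fun g =>
    (Quotient.mk (QuotientGroup.rightRel (V : Subgroup G)) g).out
  have hp : ∀ v ∈ V, ∀ g, p (v * g) = p g := by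
    intro v hv g
    refine congrArg Quotient.out (Quotient.sound ?_)
    change QuotientGroup.rightRel (V : Subgroup G) _ _
    rw [QuotientGroup.rightRel_apply, mul_inv_rev, mul_inv_cancel_left]
    exact inv_mem hv
  have hpV : ∀ g, g * (p g)⁻¹ ∈ V := by
    intro g
    have : QuotientGroup.rightRel (V : Subgroup G) (p g) g := Quotient.mk_out g
    rwa [QuotientGroup.rightRel_apply] at this
  refine ⟨V, T, hTfin, fun g f => r f (p g), fun v hv g => by simp only [hp v hv g], fun f g => ?_⟩
  have h1 := hWf f g (p g) (mem_iInter₂.mp (hV (hpV g)) f f.2)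
  have h2 := hr f (p g)
  calc _ ≤ _ := norm_sub_le_norm_sub_add_norm_sub _ (((f : RUCB G) : G →ᵇ ℂ) (p g)) _
    _ < ε / 2 + ε / 2 := add_lt_add h1 h2
    _ = ε := add_halves ε

theorem exists_approximately_invariant_measure [NonarchimedeanGroup G] [SecondCountableTopology G]
    [MeasurableSpace G] [BorelSpace G]
    (H : ∀ (_ : MulAction G (ℕ → Bool)), ContinuousSMul G (ℕ → Bool) →
      ∃ μ : Measure (ℕ → Bool), IsProbabilityMeasure μ ∧ SMulInvariantMeasure G (ℕ → Bool) μ)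
    (Φ : Finset (G × RUCB G)) {ε : ℝ} (hε : 0 < ε) :
    ∃ ν : Measure G, IsProbabilityMeasure ν ∧ ∀ p ∈ Φ,
      ‖∫ g, (RUCB.leftTranslate p.1 p.2 : G →ᵇ ℂ) g ∂ν - ∫ g, (p.2 : G →ᵇ ℂ) g ∂ν‖ ≤ ε := by
  classical
  obtain ⟨V, T, hT, F, hF, hFΦ⟩ := exists_finite_approximation (Φ.image Prod.snd) (half_pos hε)
  have := hT.to_subtype
  obtain ⟨ν, hν, hinv⟩ := exists_measure_invariant_on_finite H V.isOpen hF (Φ.image Prod.fst)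
  refine ⟨ν, hν, fun p hp => ?_⟩
  obtain ⟨s, f⟩ := p
  have hf : f ∈ Φ.image Prod.snd := Finset.mem_image_of_mem Prod.snd hp
  have hs : s ∈ Φ.image Prod.fst := Finset.mem_image_of_mem Prod.fst hp
  have hFc : Continuous F := continuous_of_invariant V.isOpen hF
  -- Translates of `f` are within `ε / 2` of translates of the step function `g ↦ F g f`.
  have happrox : ∀ t : G, ‖∫ g, (f : G →ᵇ ℂ) (t⁻¹ * g) ∂ν - ∫ g, (F (t⁻¹ * g) ⟨f, hf⟩ : ℂ) ∂ν‖ ≤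
      ε / 2 := by
    intro t
    have hi1 : Integrable (fun g => (f : G →ᵇ ℂ) (t⁻¹ * g)) ν :=
      (RUCB.leftTranslate t f : G →ᵇ ℂ).integrable ν
    have hc : Continuous fun g => (F (t⁻¹ * g) ⟨f, hf⟩ : ℂ) := by fun_prop
    have hi2 : Integrable (fun g => (F (t⁻¹ * g) ⟨f, hf⟩ : ℂ)) ν := by
      obtain ⟨C, hC⟩ := hT.isBounded.exists_norm_le
      exact Integrable.of_bound hc.measurable.aestronglyMeasurable C
        (Eventually.of_forall fun g => hC _ (F (t⁻¹ * g) ⟨f, hf⟩).2)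
    rw [← integral_sub hi1 hi2]
    refine (norm_integral_le_of_norm_le_const
      (Eventually.of_forall fun g => (hFΦ ⟨f, hf⟩ (t⁻¹ * g)).le)).trans ?_
    simp
  have h1 := happrox s
  have h2 := happrox 1
  rw [hinv s hs fun a => (a ⟨f, hf⟩ : ℂ)] at h1
  simp only [inv_one, one_mul] at h2
  rw [norm_sub_rev] at h2
  calc _ ≤ _ := norm_sub_le_norm_sub_add_norm_sub _ (∫ g, (F g ⟨f, hf⟩ : ℂ) ∂ν) _
    _ ≤ ε / 2 + ε / 2 := add_le_add h1 h2
    _ = ε := add_halves ε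

open scoped ComplexOrder in
/-- Integration against approximately invariant measures, in the limit along an ultrafilter, is an
invariant mean. -/
theorem isAmenableGroup_of_approximately_invariant [IsTopologicalGroup G]
    [SecondCountableTopology G] [MeasurableSpace G] [BorelSpace G]
    (H : ∀ (Φ : Finset (G × RUCB G)) (ε : ℝ), 0 < ε →
      ∃ ν : Measure G, IsProbabilityMeasure ν ∧ ∀ p ∈ Φ,
        ‖∫ g, (RUCB.leftTranslate p.1 p.2 : G →ᵇ ℂ) g ∂ν - ∫ g, (p.2 : G →ᵇ ℂ) g ∂ν‖ ≤ ε) :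
    IsAmenableGroup G := by
  classical
  choose ν hν hinv using fun i : Finset (G × RUCB G) × ℕ =>
    H i.1 (1 / ((i.2 : ℝ) + 1)) Nat.one_div_pos_of_nat
  let U : Ultrafilter (Finset (G × RUCB G) × ℕ) := Ultrafilter.of atTop
  have hU : (U : Filter (Finset (G × RUCB G) × ℕ)) ≤ atTop := Ultrafilter.of_le atTop
  have hlim : ∀ f : RUCB G, ∃ z : ℂ, Tendsto (fun i => ∫ g, (f : G →ᵇ ℂ) g ∂(ν i)) U (𝓝 z) := by
    intro f
    obtain ⟨z, -, hz⟩ := (isCompact_closedBall (0 : ℂ) ‖f‖).ultrafilter_le_nhds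
      (U.map fun i => ∫ g, (f : G →ᵇ ℂ) g ∂(ν i)) (by
        refine le_principal_iff.mpr (Ultrafilter.mem_map.mpr (Eventually.of_forall fun i => ?_))
        rw [mem_closedBall_zero_iff]
        exact (f : G →ᵇ ℂ).norm_integral_le_norm (ν i))
    exact ⟨z, hz⟩
  choose m hm using hlim
  have hI : ∀ (f : RUCB G) i, Integrable (f : G →ᵇ ℂ) (ν i) := fun f i =>
    (f : G →ᵇ ℂ).integrable (ν i)
  refine ⟨⟨⟨m, fun f k => ?_⟩, fun c f => ?_⟩, ?_, fun f => ?_, fun f hf => ?_, fun s f => ?_⟩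
  · refine tendsto_nhds_unique (hm (f + k)) (((hm f).add (hm k)).congr fun i => ?_)
    exact (integral_add (hI f i) (hI k i)).symm
  · refine tendsto_nhds_unique (hm (c • f)) (((hm f).const_mul c).congr fun i => ?_)
    exact (integral_const_mul c _).symm
  · refine tendsto_nhds_unique (hm 1) (tendsto_const_nhds.congr fun i => ?_)
    change 1 = ∫ _, (1 : ℂ) ∂(ν i)
    simp
  · refine tendsto_nhds_unique (hm (star f)) ((hm f).star.congr fun i => ?_)
    exact integral_conj.symm
  · exact ge_of_tendsto' (hm f) fun i => integral_nonneg hf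
  · change m _ = m f
    have hzero : Tendsto (fun i => ∫ g, (RUCB.leftTranslate s f : G →ᵇ ℂ) g ∂(ν i) -
        ∫ g, (f : G →ᵇ ℂ) g ∂(ν i)) U (𝓝 0) := by
      have hn : Tendsto (fun i : Finset (G × RUCB G) × ℕ => 1 / ((i.2 : ℝ) + 1)) U (𝓝 0) :=
        (tendsto_one_div_add_atTop_nhds_zero_nat.comp
          (tendsto_snd.mono_left (hU.trans prod_atTop_atTop_eq.ge)))
      refine squeeze_zero_norm' ?_ hn
      filter_upwards [hU (mem_atTop ({(s, f)}, 0))] with i hi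
      exact hinv i (s, f) (hi.1 (Finset.mem_singleton_self _))
    exact sub_eq_zero.mp (tendsto_nhds_unique ((hm _).sub (hm f)) hzero)

end Converse

/-! ### The Cantor space as a test space -/

theorem mainTheorem2 {G : Type*} [Group G] [TopologicalSpace G] [NonarchimedeanGroup G]
    [PolishSpace G] :
    IsAmenableGroup G ↔
      ∀ (_ : MulAction G (ℕ → Bool)), ContinuousSMul G (ℕ → Bool) →
        ∃ μ : Measure (ℕ → Bool), IsProbabilityMeasure μ ∧
          SMulInvariantMeasure G (ℕ → Bool) μ := by
  refine ⟨fun hG _ _ => hG.exists_invariant_measure, fun H => ?_⟩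
  let _ : MeasurableSpace G := borel G
  have : BorelSpace G := ⟨rfl⟩
  exact isAmenableGroup_of_approximately_invariant fun Φ ε hε =>
    exists_approximately_invariant_measure H Φ hε
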